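/- For a topological space $X$, write $y\le z$ when $y$ lies in the closure of $\{z\}$ (the specialization order), and for $F\subseteq X$ let ${\uparrow}F=\{z\in X : y\le z \text{ for some } y\in F\}$. A $T_0$ space $X$ is called \emph{locally finitary compact} if for every $x\in X$ and every open neighbourhood $U$ of $x$ there is a finite set $F\subseteq U$ such that $x$ lies in the interior of ${\uparrow}F$. The category of locally finitary compact ($T_0$) spaces and continuous maps, whose finite products are the one-point space and the topological products, is not cartesian closed. -/

import Mathlib

open CategoryTheory Limits TopologicalSpace

universe u

/-- A topological space `X` is locally finitary compact if, for every point `x` and every open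
neighbourhood `U` of `x`, there is a finite subset `F` of `U` with `x` in the interior of `↑F`.
Here `↑F` is the upward closure of `F` in the specialization order, in which `y ≤ z` means that
`y` lies in the closure of `{z}`. -/
def IsLocallyFinitaryCompact (X : Type u) [TopologicalSpace X] : Prop :=
  ∀ (x : X) (U : Set X), IsOpen U → x ∈ U →
    ∃ F : Set X, F.Finite ∧ F ⊆ U ∧ x ∈ interior {z : X | ∃ y ∈ F, y ∈ closure {z}}

theorem IsLocallyFinitaryCompact.punit : IsLocallyFinitaryCompact PUnit.{u + 1} := by
  intro x U _ hxU
  refine ⟨{x}, Set.finite_singleton x, by simpa using hxU, ?_⟩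
  simp

theorem IsLocallyFinitaryCompact.prod {X Y : Type u} [TopologicalSpace X] [TopologicalSpace Y]
    (hX : IsLocallyFinitaryCompact X) (hY : IsLocallyFinitaryCompact Y) :
    IsLocallyFinitaryCompact (X × Y) := by
  rintro ⟨a, b⟩ W hW hab
  obtain ⟨U, V, hU, hV, ha, hb, hUV⟩ := isOpen_prod_iff.1 hW a b hab
  obtain ⟨F, hF, hFU, haF⟩ := hX a U hU ha
  obtain ⟨G, hG, hGV, hbG⟩ := hY b V hV hb
  refine ⟨F ×ˢ G, hF.prod hG, (Set.prod_mono hFU hGV).trans hUV, ?_⟩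
  refine interior_mono ?_ ((interior_prod_eq _ _).symm.subset (Set.mk_mem_prod haF hbG))
  rintro ⟨p, q⟩ ⟨⟨y, hy, hyp⟩, ⟨z, hz, hzq⟩⟩
  refine ⟨(y, z), ⟨hy, hz⟩, ?_⟩
  rw [← Set.singleton_prod_singleton, closure_prod_eq]
  exact ⟨hyp, hzq⟩

/-- The category of (`T₀`) locally finitary compact spaces, as the full subcategory of the category
of topological spaces and continuous maps. -/
abbrev LocFinCompact : Type (u + 1) :=
  ObjectProperty.FullSubcategory
    (fun X : TopCat.{u} => T0Space X ∧ IsLocallyFinitaryCompact X)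

namespace LocFinCompact

/-- The one-point space. -/
abbrev point : LocFinCompact.{u} :=
  ⟨TopCat.of PUnit, inferInstanceAs (T0Space PUnit), .punit⟩

/-- The topological product of two locally finitary compact spaces. -/
abbrev prodObj (X Y : LocFinCompact.{u}) : LocFinCompact.{u} :=
  ⟨TopCat.of (X.obj × Y.obj),
    haveI := X.property.1
    haveI := Y.property.1
    inferInstanceAs (T0Space (X.obj × Y.obj)), X.property.2.prod Y.property.2⟩

/-- The topological product with its two projections. -/
abbrev prodFan (X Y : LocFinCompact.{u}) : BinaryFan X Y :=
  BinaryFan.mk (P := prodObj X Y)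
    (ObjectProperty.homMk (TopCat.ofHom ⟨Prod.fst, continuous_fst⟩))
    (ObjectProperty.homMk (TopCat.ofHom ⟨Prod.snd, continuous_snd⟩))

/-- The topological product is the categorical product. -/
def prodFanIsLimit (X Y : LocFinCompact.{u}) : IsLimit (prodFan X Y) :=
  BinaryFan.IsLimit.mk _
    (fun f g => ObjectProperty.homMk
      (TopCat.ofHom ⟨fun t => (f.hom t, g.hom t), by fun_prop⟩))
    (fun _ _ => rfl) (fun _ _ => rfl)
    (fun f g m hf hg => by
      subst hf hg
      rfl)

/-- The one-point space is terminal. -/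
def pointIsTerminal : IsTerminal point.{u} :=
  IsTerminal.ofUniqueHom
    (fun _ => ObjectProperty.homMk (TopCat.ofHom ⟨fun _ => PUnit.unit, continuous_const⟩))
    (fun _ _ => rfl)

/-- The finite products of the category, given by the one-point space and topological products. -/
instance : CartesianMonoidalCategory LocFinCompact.{u} :=
  .ofChosenFiniteProducts ⟨_, pointIsTerminal⟩ (fun X Y => ⟨prodFan X Y, prodFanIsLimit X Y⟩)

end LocFinCompact

/-! An exponential `E` of `Vee` by discrete ℕ would have to contain, for each `h`, a sequence of
points converging to the constantly-`none` point `e`, the `n`-th agreeing with `h` at all places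
from `n` on. Local finitary compactness at `e` gives a finite `F` such that every such sequence
eventually lies above some member of `F`. A diagonal `h`, differing from each member at arbitrarily
late places, contradicts this, since `some b` is minimal in `Vee`. -/

/-- Two incomparable points `some false`, `some true` below a top element `none`, with the topology
of upper sets. -/
def Vee : Type u := ULift.{u} (Option Bool)

namespace Vee

/-- The points of `Vee`. -/
def mk (o : Option Bool) : Vee.{u} := ULift.up o

theorem mk_injective : Function.Injective mk.{u} := fun _ _ h => congrArg ULift.down h

instance : Finite Vee.{u} := inferInstanceAs (Finite (ULift.{u} (Option Bool)))

instance : TopologicalSpace Vee.{u} where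
  IsOpen U := ∀ x ∈ U, mk none ∈ U
  isOpen_univ := by simp
  isOpen_inter U V hU hV x hx := ⟨hU x hx.1, hV x hx.2⟩
  isOpen_sUnion S hS := by
    rintro x ⟨U, hU, hx⟩
    exact ⟨U, hU, hS U hU x hx⟩

theorem isOpen_iff {U : Set Vee.{u}} : IsOpen U ↔ ∀ x ∈ U, mk none ∈ U := Iff.rfl

instance : T0Space Vee.{u} := by
  refine ⟨fun x y h => ?_⟩
  have key (z : Vee.{u}) : x = mk none ∨ x = z ↔ y = mk none ∨ y = z :=
    h.mem_open_iff (s := {w | w = mk none ∨ w = z}) (isOpen_iff.2 fun _ _ => Or.inl rfl)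
  have h0 := key (mk none)
  have hx := (key x).1 (Or.inr rfl)
  grind

theorem isLocallyFinitaryCompact : IsLocallyFinitaryCompact Vee.{u} := by
  intro x U hU hx
  refine ⟨U, Set.toFinite U, subset_rfl, mem_interior.2 ⟨U, fun y hy => ?_, hU, hx⟩⟩
  exact ⟨y, hy, subset_closure rfl⟩

/-- Closed points are minimal for specialization, so whatever lies below `some b` equals it. -/
theorem isClosed_singleton_some (b : Bool) : IsClosed {mk.{u} (some b)} := by
  refine ⟨isOpen_iff.2 fun x _ h => ?_⟩
  cases mk_injective h

end Vee

/-- The chain of extended natural numbers, with its Scott topology. -/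
def ScottENat : Type u := ULift.{u} ℕ∞

namespace ScottENat

/-- The points of `ScottENat`. -/
def mk (n : ℕ∞) : ScottENat.{u} := ULift.up n

/-- The extended natural number underlying a point. -/
def val (x : ScottENat.{u}) : ℕ∞ := ULift.down x

theorem val_injective : Function.Injective val.{u} := ULift.down_injective

instance : TopologicalSpace ScottENat.{u} where
  IsOpen U := ∀ x ∈ U, ∃ n : ℕ, (n : ℕ∞) ≤ x.val ∧ ∀ y : ScottENat.{u}, (n : ℕ∞) ≤ y.val → y ∈ U
  isOpen_univ x _ := ⟨0, by simp, by simp⟩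
  isOpen_inter U V hU hV x hx := by
    obtain ⟨n, hn, hnU⟩ := hU x hx.1
    obtain ⟨m, hm, hmV⟩ := hV x hx.2
    have hmax : ((max n m : ℕ) : ℕ∞) = max (n : ℕ∞) m := (Nat.mono_cast (α := ℕ∞)).map_max
    refine ⟨max n m, hmax.trans_le (max_le hn hm), fun y hy => ?_⟩
    have hy' := max_le_iff.1 (hmax.symm.trans_le hy)
    exact ⟨hnU y hy'.1, hmV y hy'.2⟩
  isOpen_sUnion S hS := by
    rintro x ⟨U, hU, hx⟩
    obtain ⟨n, hn, hnU⟩ := hS U hU x hx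
    exact ⟨n, hn, fun y hy => ⟨U, hU, hnU y hy⟩⟩

theorem isOpen_iff {U : Set ScottENat.{u}} : IsOpen U ↔
    ∀ x ∈ U, ∃ n : ℕ, (n : ℕ∞) ≤ x.val ∧ ∀ y : ScottENat.{u}, (n : ℕ∞) ≤ y.val → y ∈ U :=
  Iff.rfl

theorem isOpen_setOf_le (n : ℕ) : IsOpen {x : ScottENat.{u} | (n : ℕ∞) ≤ x.val} :=
  isOpen_iff.2 fun _ hx => ⟨n, hx, fun _ => id⟩

instance : T0Space ScottENat.{u} :=
  ⟨fun _ _ h => val_injective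
    (ENat.eq_of_forall_natCast_le_iff fun n => h.mem_open_iff (isOpen_setOf_le n))⟩

theorem isLocallyFinitaryCompact : IsLocallyFinitaryCompact ScottENat.{u} := by
  intro x U hU hx
  obtain ⟨n, hn, hnU⟩ := isOpen_iff.1 hU x hx
  refine ⟨{mk n}, Set.finite_singleton _, Set.singleton_subset_iff.2 (hnU _ le_rfl),
    mem_interior.2 ⟨_, fun y hy => ⟨mk n, rfl, ?_⟩, isOpen_setOf_le n, hn⟩⟩
  refine mem_closure_iff.2 fun V hV hnV => ⟨y, ?_, rfl⟩
  obtain ⟨m, hm, hmV⟩ := isOpen_iff.1 hV _ hnV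
  exact hmV y (hm.trans hy)

/-- An open set containing `∞` contains a natural number. -/
theorem exists_natCast_mem {U : Set ScottENat.{u}} (hU : IsOpen U) (h : mk ⊤ ∈ U) :
    ∃ n : ℕ, mk n ∈ U := by
  obtain ⟨n, _, hn⟩ := isOpen_iff.1 hU _ h
  exact ⟨n, hn _ le_rfl⟩

end ScottENat

theorem IsLocallyFinitaryCompact.of_discreteTopology (X : Type u) [TopologicalSpace X]
    [DiscreteTopology X] : IsLocallyFinitaryCompact X := by
  intro x U _ hx
  refine ⟨{x}, Set.finite_singleton x, by simpa using hx, ?_⟩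
  simp [(isOpen_discrete {x}).interior_eq]

/-- The sequence in `Vee` that is `none` before the `x`-th place and is given by `h` from there on;
it depends continuously on `x`. -/
def cutoff (h : ℕ → Bool) (p : ULift.{u} ℕ × ScottENat.{u}) : Vee.{u} :=
  open Classical in if (p.1.down : ℕ∞) < p.2.val then Vee.mk none else Vee.mk (some (h p.1.down))

theorem continuous_cutoff (h : ℕ → Bool) : Continuous (cutoff.{u} h) := by
  -- The first factor is discrete, so each coordinate `i` is checked separately.
  refine continuous_prod_of_discrete_left.2 fun i => ⟨fun U hU => ?_⟩
  refine ScottENat.isOpen_iff.2 fun x hx => ?_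
  have hnone : Vee.mk none ∈ U := Vee.isOpen_iff.1 hU _ hx
  by_cases hix : (i.down : ℕ∞) < x.val
  · refine ⟨i.down + 1, by simpa using Order.add_one_le_of_lt hix, fun y hy => ?_⟩
    have hiy : (i.down : ℕ∞) < y.val :=
      lt_of_lt_of_le (by exact_mod_cast Nat.lt_succ_self i.down) hy
    simpa [cutoff, hiy] using hnone
  · have hi : Vee.mk (some (h i.down)) ∈ U := by simpa [cutoff, hix] using hx
    refine ⟨0, by simp, fun y _ => ?_⟩
    by_cases hiy : (i.down : ℕ∞) < y.val
    · simpa [cutoff, hiy] using hnone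
    · simpa [cutoff, hiy] using hi

theorem cutoff_top (h : ℕ → Bool) (i : ULift.{u} ℕ) :
    cutoff h (i, ScottENat.mk ⊤) = Vee.mk none :=
  if_pos (ENat.natCast_lt_top i.down)

theorem cutoff_of_le (h : ℕ → Bool) {i n : ℕ} (hn : n ≤ i) :
    cutoff.{u} h (ULift.up i, ScottENat.mk n) = Vee.mk (some (h i)) :=
  if_neg (by simpa [ScottENat.val, ScottENat.mk] using hn)

/-- In a locally finitary compact space with a continuous evaluation of its points as sequences in
`Vee`, not every sequence `cutoff h` can be represented by a continuous map with a fixed value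
at `∞`. -/
theorem not_forall_exists_cutoff_eq {E : Type u} [TopologicalSpace E]
    (hE : IsLocallyFinitaryCompact E) {ev : ULift.{u} ℕ × E → Vee.{u}} (hev : Continuous ev)
    (e : E) :
    ¬ ∀ h : ℕ → Bool, ∃ φ : ScottENat.{u} → E, Continuous φ ∧ φ (ScottENat.mk ⊤) = e ∧
      ∀ i x, ev (i, φ x) = cutoff h (i, x) := by
  intro H
  obtain ⟨F, hF, -, heF⟩ := hE e Set.univ isOpen_univ trivial
  obtain ⟨f, hf, -⟩ := interior_subset heF
  obtain ⟨s, rfl⟩ := hF.countable.exists_eq_range ⟨f, hf⟩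
  -- Pairing assigns infinitely many places `i` to each `s j`; `h` avoids the value of `s j` at all
  -- of them.
  have hne (i : ℕ) :
      ∃ b : Bool, ev (ULift.up i, s (Nat.unpair i).1) ≠ Vee.mk (some b) := by
    by_contra! hcon
    have := Vee.mk_injective ((hcon true).symm.trans (hcon false))
    simp at this
  choose h hh using hne
  obtain ⟨φ, hφ, hφe, hφev⟩ := H h
  obtain ⟨n, hn⟩ := ScottENat.exists_natCast_mem (isOpen_interior.preimage hφ) (by
    rw [Set.mem_preimage, hφe]; exact heF)
  obtain ⟨_, ⟨j, rfl⟩, hj⟩ := interior_subset hn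
  -- Evaluation at `Nat.pair j n`, a place of `s j` that is at least `n`, preserves specialization.
  have hcl := map_mem_closure (hev.comp (Continuous.prodMk_right (ULift.up (Nat.pair j n)))) hj
    (t := {Vee.mk (some (h (Nat.pair j n)))}) (by
      rintro _ rfl
      exact (hφev _ _).trans (cutoff_of_le h (Nat.right_le_pair j n)))
  rw [(Vee.isClosed_singleton_some _).closure_eq] at hcl
  have := hh (Nat.pair j n)
  rw [Nat.unpair_pair] at this
  exact this hcl

namespace LocFinCompact

/-- The discrete space of natural numbers. -/
abbrev natObj : LocFinCompact.{u} :=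
  ⟨TopCat.of (ULift.{u} ℕ), inferInstanceAs (T0Space (ULift.{u} ℕ)), .of_discreteTopology _⟩

/-- `Vee` as an object of the category. -/
abbrev veeObj : LocFinCompact.{u} :=
  ⟨TopCat.of Vee.{u}, inferInstanceAs (T0Space Vee.{u}), Vee.isLocallyFinitaryCompact⟩

/-- `ScottENat` as an object of the category. -/
abbrev scottENatObj : LocFinCompact.{u} :=
  ⟨TopCat.of ScottENat.{u}, inferInstanceAs (T0Space ScottENat.{u}),
    ScottENat.isLocallyFinitaryCompact⟩

open MonoidalCategory

/-- `cutoff h` as a morphism. -/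
def cutoffHom (h : ℕ → Bool) : natObj.{u} ⊗ scottENatObj.{u} ⟶ veeObj.{u} :=
  ObjectProperty.homMk (TopCat.ofHom ⟨cutoff h, continuous_cutoff h⟩)

/-- The point `∞` of the chain, as a morphism. -/
def topHom : point.{u} ⟶ scottENatObj.{u} :=
  ObjectProperty.homMk (TopCat.ofHom ⟨fun _ => ScottENat.mk ⊤, continuous_const⟩)

/-- By naturality of currying, this makes the value at `∞` of the curried map independent of `h`. -/
theorem whiskerLeft_topHom_comp_cutoffHom (h h' : ℕ → Bool) :
    natObj.{u} ◁ topHom ≫ cutoffHom h = natObj.{u} ◁ topHom ≫ cutoffHom h' := by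
  ext p
  exact (cutoff_top h p.1).trans (cutoff_top h' p.1).symm

end LocFinCompact

open LocFinCompact MonoidalCategory in
/-- The category of locally finitary compact spaces and continuous maps, with its finite products,
is not cartesian closed. -/
theorem mainTheorem2 : IsEmpty (MonoidalClosed LocFinCompact.{u}) := by
  refine ⟨fun _ => ?_⟩
  let E := (ihom natObj.{u}).obj veeObj
  let ev : natObj.{u} ⊗ E ⟶ veeObj := (ihom.ev natObj).app veeObj
  let φ (h : ℕ → Bool) : scottENatObj.{u} ⟶ E := MonoidalClosed.curry (cutoffHom h)
  refine not_forall_exists_cutoff_eq E.property.2 (ev := fun p => ev.hom p) ev.hom.hom.continuous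
    ((φ fun _ => true).hom (ScottENat.mk ⊤)) fun h =>
    ⟨fun x => (φ h).hom x, (φ h).hom.hom.continuous, ?_, fun i x => ?_⟩
  · have hφ : topHom ≫ φ h = topHom ≫ φ fun _ => true := by
      rw [← MonoidalClosed.curry_natural_left, ← MonoidalClosed.curry_natural_left,
        whiskerLeft_topHom_comp_cutoffHom]
    exact congrArg (fun f : point.{u} ⟶ E => f.hom PUnit.unit) hφ
  · have hφ : natObj.{u} ◁ φ h ≫ ev = cutoffHom h := by
      rw [← MonoidalClosed.uncurry_eq, MonoidalClosed.uncurry_curry]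
    exact congrArg (fun f : natObj.{u} ⊗ scottENatObj ⟶ veeObj => f.hom (i, x)) hφ
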